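/- **Setting.** A binary linear model (BLM) is a finite directed acyclic graph whose nodes carry $\{0,1\}$-valued variables. One node has constant value $1$ and no incoming edges. Each edge $(Z,X)$ has a weight $\theta_{Z,X}\in[0,1]$. The nodes $X$ other than the constant node carry mutually independent zero-mean sub-Gaussian noises $\varepsilon_X$ (possibly identically $0$) such that, for every value $pa(X)$ of the parents in which the constant node has value $1$, almost surely $\theta_X\cdot pa(X)+\varepsilon_X\in[0,1]$. Given the parents and the noise, $\Pr\{X=1\mid Pa(X)=pa(X)\}=\theta_X\cdot pa(X)+\varepsilon_X$. The joint law under an intervention $do(S=s)$ is the truncated factorization, averaged over the noises. A BLM is Markovian if it has no hidden nodes and its constant node is a parent of every other node. Let $G$ be a BLM with node set $\mathbf U\cup\mathbf X\cup\{Y\}$, where $\mathbf U$ is the set of hidden nodes, $\mathbf X\cup\{Y\}$ is the set of observed nodes, the constant node is $U_0\in\mathbf U$, and $Y$ has no outgoing edges. A hidden path from $A$ to $B$ is a directed path with at least one edge all of whose intermediate nodes (if any) are hidden. Assume that there are no hidden node $U_s\neq U_0$ and observed nodes $X_i,X_j$, with $X_j$ a descendant of $X_i$ in $G$, such that there are hidden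 paths from $U_s$ to $X_i$ and from $U_s$ to $X_j$. The transformed model $G'$ has node set $\{X_1\}\cup\mathbf X\cup\{Y\}$, where $X_1$ is a new constant node of value $1$ and no node is hidden. For $X_i,X_j\in\mathbf X\cup\{Y\}$ it has the edge $(X_i,X_j)$ if and only if $G$ has a hidden path from $X_i$ to $X_j$, with weight $\theta'_{X_i,X_j}=\sum_P\prod_{e\in P}\theta_e$, the sum being over all hidden paths $P$ from $X_i$ to $X_j$. For every $X_i\in\mathbf X\cup\{Y\}$ it has the edge $(X_1,X_i)$ with weight $\theta'_{X_1,X_i}=\Pr\{X_i=1\mid do(\mathbf X\cup\{Y\}\setminus\{X_i\}=\mathbf 0)\}$. The noises of the nodes in $\mathbf X\cup\{Y\}$ are unchanged. Denote parents and probabilities in $G'$ by $Pa'$ and $\Pr'$. **Lemma (parent–child conditional equivalence).** $G'$ is a Markovian BLM. Moreover, let $X\in\mathbf X\cup\{Y\}$, $S\subseteq\mathbf X$, $s\in\{0,1\}^{S}$, and let $pa'(X)\in\{0,1\}^{Pa'(X)}$ have $X_1$-entry $x_1=1$ and agree with $s$ on $S\cap Pa'(X)$. If the event $Pa'(X)\setminus\{X_1\}=pa'(X)\setminus\{x_1\}$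 has positive probability in $G$ under $do(S=s)$, then the event $Pa'(X)=pa'(X)$ has positive probability in $G'$ under $do(S=s)$, and $$\Pr\{X=1\mid Pa'(X)\setminus\{X_1\}=pa'(X)\setminus\{x_1\},\,do(S=s)\}=\Pr{}'\{X=1\mid Pa'(X)=pa'(X),\,do(S=s)\}.$$ -/

import Mathlib

open MeasureTheory ProbabilityTheory

noncomputable section

/-- The data of a linear causal model on binary variables indexed by `V`: a directed graph, edge
weights, the laws of the (mutually independent) noise variables, the set of hidden nodes, the node
`unit` whose variable is constantly `1` (it is `U₀` in a model with hidden variables and `X₁` in a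
Markovian model), and the observed target node. The values `true` and `false` are `1` and `0`. -/
structure LinearCausalModel (V : Type*) where
  edge : V → V → Prop
  weight : V → V → ℝ
  noise : V → Measure ℝ
  hidden : Set V
  unit : V
  target : V
  target_observed : target ∉ hidden

namespace LinearCausalModel

variable {V : Type*}

/-- The observed nodes. -/
abbrev Obs (G : LinearCausalModel V) : Type _ := {v : V // v ∉ G.hidden}

instance instFintypeObs [Fintype V] (G : LinearCausalModel V) : Fintype G.Obs :=
  Fintype.ofFinite _

open Classical in
/-- The scalar product `θ_v · pa(v)` of the weights into `v` and the values of the parents. -/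
def response [Fintype V] (G : LinearCausalModel V) (v : V) (x : V → Bool) : ℝ :=
  ∑ u with G.edge u v, G.weight u v * (if x u then 1 else 0)

/-- `G` is a binary linear model: an acyclic graph, weights in `[0,1]`, and independent zero-mean
sub-Gaussian noises such that `θ_v · pa(v) + ε_v` is almost surely a probability whatever the values
of the parents are (the constant node having value `1`). A hidden node may have a noise too; it has
none if its noise law is the Dirac mass at `0`. -/
structure IsBLM [Fintype V] (G : LinearCausalModel V) : Prop where
  acyclic : ∀ v, ¬ Relation.TransGen G.edge v v
  no_edge_into_unit : ∀ v, ¬ G.edge v G.unit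
  no_edge_from_target : ∀ v, ¬ G.edge G.target v
  target_ne_unit : G.target ≠ G.unit
  weight_mem : ∀ u v, G.edge u v → G.weight u v ∈ Set.Icc (0 : ℝ) 1
  noise_prob : ∀ v, IsProbabilityMeasure (G.noise v)
  noise_subgaussian : ∀ v, v ≠ G.unit → ∃ c, HasSubgaussianMGF (fun e : ℝ => e) c (G.noise v)
  noise_mean : ∀ v, v ≠ G.unit → ∫ e, e ∂(G.noise v) = 0
  prob_mem : ∀ v, v ≠ G.unit → ∀ x : V → Bool, x G.unit = true →
    ∀ᵐ e ∂(G.noise v), G.response v x + e ∈ Set.Icc (0 : ℝ) 1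

/-- There are no hidden nodes, and the constant node is a parent of all other nodes. -/
def IsMarkovian (G : LinearCausalModel V) : Prop :=
  G.hidden = ∅ ∧ ∀ v, v ≠ G.unit → G.edge G.unit v

open Classical in
/-- The factor of node `v` in the truncated factorization of `do(S = s)`, given that the noise of
`v` is `e`: an intervened node has its prescribed value, the constant node has value `1`, and any
other node has value `1` with probability `θ_v · pa(v) + e`. -/
def factor [Fintype V] (G : LinearCausalModel V) (S : Set V) (s : V → Bool) (v : V) (e : ℝ)
    (x : V → Bool) : ℝ :=
  if v ∈ S then (if x v = s v then 1 else 0)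
  else if v = G.unit then (if x v then 1 else 0)
  else if x v then G.response v x + e else 1 - (G.response v x + e)

/-- The probability of the joint value `x` of all variables under `do(S = s)`: the truncated
factorization, averaged over the independent noises. -/
def jointProb [Fintype V] (G : LinearCausalModel V) (S : Set V) (s : V → Bool)
    (x : V → Bool) : ℝ :=
  ∫ ε : V → ℝ, ∏ v, G.factor S s v (ε v) x ∂(Measure.pi G.noise)

open Classical in
/-- The joint law of all variables under the intervention `do(S = s)`; only the values of `s` on
`S` matter. -/
def doLaw [Fintype V] (G : LinearCausalModel V) (S : Set V) (s : V → Bool) :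
    Measure (V → Bool) :=
  ∑ x : V → Bool, ENNReal.ofReal (G.jointProb S s x) • Measure.dirac x

/-- `p` lists the intermediate nodes of a directed path from `a` to `b`, and all of them are
hidden. -/
def IsHiddenPath (G : LinearCausalModel V) : V → List V → V → Prop
  | a, [], b => G.edge a b
  | a, c :: p, b => G.edge a c ∧ c ∈ G.hidden ∧ IsHiddenPath G c p b

/-- The product of the weights along the path from `a` to `b` with intermediate nodes `p`. -/
def pathWeight (G : LinearCausalModel V) : V → List V → V → ℝ
  | a, [], b => G.weight a b
  | a, c :: p, b => G.weight a c * pathWeight G c p b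

/-- No hidden node other than the constant node has hidden paths both to an observed node `a` and
to an observed descendant `b` of `a`. -/
def NoHiddenForkToDescendant (G : LinearCausalModel V) : Prop :=
  ∀ u ∈ G.hidden, u ≠ G.unit → ∀ a b : G.Obs, Relation.TransGen G.edge a b →
    ¬ ((∃ p, G.IsHiddenPath u p a) ∧ ∃ q, G.IsHiddenPath u q b)

/-- The transformed model on the observed nodes and a new constant node, `none`. -/
def transform [Fintype V] (G : LinearCausalModel V) : LinearCausalModel (Option G.Obs) where
  edge
    | some a, some b => ∃ p, G.IsHiddenPath a p b
    | none, some _ => True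
    | _, none => False
  weight
    | some a, some b => ∑ᶠ p ∈ {p : List V | G.IsHiddenPath a p b}, G.pathWeight a p b
    | none, some b =>
        (G.doLaw {v | v ∉ G.hidden ∧ v ≠ b} (fun _ => false)).real {x | x b = true}
    | _, none => 0
  noise
    | some b => G.noise b
    | none => Measure.dirac 0
  hidden := ∅
  unit := none
  target := some ⟨G.target, G.target_observed⟩
  target_observed := Set.notMem_empty _

/-- The intervened nodes, as nodes of the transformed model. -/
def liftNodes (G : LinearCausalModel V) (S : Set V) : Set (Option G.Obs) :=
  {w | ∃ a : G.Obs, w = some a ∧ (a : V) ∈ S}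

/-- The intervened values, as values in the transformed model. -/
def liftValues (G : LinearCausalModel V) (s : V → Bool) : Option G.Obs → Bool
  | some a => s a
  | none => true

end LinearCausalModel

end

noncomputable section

namespace LinearCausalModel

open Classical

/-! Each factor is affine in its own noise and the noises are independent with mean zero, so
averaging simply sets them to `0`; probabilities become finite sums `expect`. The causal Markov
property (`expect_ind_mul`) replaces the indicator of a node by its response against any function of
its non-descendants. Iterating it upwards through hidden parents (`expect_ind_mul_eq_linPart`)
replaces the indicator by an affine function of observed nodes, with sums over hidden paths as
coefficients. This iteration needs the test function to ignore the descendants of every hidden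
ancestor met on the way. For the indicator of the parent event, that is what the fork assumption
provides. On this event the affine function is constant and equals the response in the transformed
model, where the Markov property applies directly; hence both conditional probabilities equal that
response. The transformed model is a BLM because its response is an average of responses of `G`
under an intervention on all other observed nodes. Positivity passes over atom by atom
(`truncProb_transform_ne_zero`). -/

theorem _root_.DependsOn.update_eq {V : Type*} {f : (V → Bool) → ℝ} {D : Set V} (hf : DependsOn f Dᶜ)
    {w : V} (hw : w ∈ D) (x : V → Bool) (b : Bool) : f (Function.update x w b) = f x := by
  refine hf fun i hi => ?_
  have : i ≠ w := by
    rintro rfl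
    exact hi hw
  simp [this]

/-! ### Truncated factorization without noise, and the causal Markov property. -/

section Expectation

variable {V : Type*} [Fintype V]

/-- The probability of `x` under `do(S = s)` when every noise is replaced by its mean `0`. -/
def truncProb (G : LinearCausalModel V) (S : Set V) (s x : V → Bool) : ℝ :=
  ∏ v, G.factor S s v 0 x

/-- The expectation of `f` under `truncProb`. -/
def expect (G : LinearCausalModel V) (S : Set V) (s : V → Bool) (f : (V → Bool) → ℝ) : ℝ :=
  ∑ x, G.truncProb S s x * f x

/-- The numerical value of a Boolean. -/
def ind (b : Bool) : ℝ := if b then 1 else 0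

/-- Flipping coordinate `w` is an involution, so summing over pairs counts every point twice. This
is how a single node is summed out. -/
theorem sum_eq_of_update_pairs (w : V) {F F' : (V → Bool) → ℝ}
    (h : ∀ x, F (Function.update x w true) + F (Function.update x w false) =
      F' (Function.update x w true) + F' (Function.update x w false)) :
    ∑ x, F x = ∑ x, F' x := by
  have key : ∀ K : (V → Bool) → ℝ, 2 * ∑ x, K x =
      ∑ x, (K (Function.update x w true) + K (Function.update x w false)) := by
    intro K
    have hinv : Function.Involutive (fun x : V → Bool => Function.update x w (!x w)) := by
      intro x
      simp
    have h1 : ∑ x, K (Function.update x w (!x w)) = ∑ x, K x :=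
      Equiv.sum_comp hinv.toPerm K
    rw [two_mul]
    nth_rewrite 2 [← h1]
    rw [← Finset.sum_add_distrib]
    refine Finset.sum_congr rfl fun x _ => ?_
    cases hx : x w
    · have : Function.update x w false = x := by rw [← hx]; simp
      simp [this, add_comm]
    · have : Function.update x w true = x := by rw [← hx]; simp
      simp [this]
  have := key F
  have h2 := key F'
  rw [Finset.sum_congr rfl fun x _ => h x, ← h2] at this
  linarith

variable {G : LinearCausalModel V} {S : Set V} {s : V → Bool}

theorem response_congr {v : V} {x y : V → Bool} (h : ∀ u, G.edge u v → x u = y u) :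
    G.response v x = G.response v y := by
  unfold response
  refine Finset.sum_congr rfl fun u hu => ?_
  rw [h u (Finset.mem_filter.mp hu).2]

theorem factor_update_of_ne {v w : V} (hvw : v ≠ w) (h : G.edge w v → v ∈ S) (x : V → Bool)
    (b : Bool) : G.factor S s v 0 (Function.update x w b) = G.factor S s v 0 x := by
  unfold factor
  by_cases hv : v ∈ S
  · simp [hv, hvw]
  · have : G.response v (Function.update x w b) = G.response v x := by
      refine response_congr fun u hu => ?_
      have : u ≠ w := by
        rintro rfl
        exact hv (h hu)
      simp [this]
    simp [hv, hvw, this]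

theorem truncProb_update {w : V} (h : ∀ u, G.edge w u → u ∈ S) (x : V → Bool) (b : Bool) :
    G.truncProb S s (Function.update x w b) =
      G.factor S s w 0 (Function.update x w b) *
        ∏ v ∈ Finset.univ.erase w, G.factor S s v 0 x := by
  unfold truncProb
  rw [← Finset.mul_prod_erase _ _ (Finset.mem_univ w)]
  congr 1
  exact Finset.prod_congr rfl fun v hv =>
    factor_update_of_ne (Finset.ne_of_mem_erase hv) (h v) x b

theorem factor_add_factor {w : V} (hw : ¬ G.edge w w) (x : V → Bool) :
    G.factor S s w 0 (Function.update x w true) +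
      G.factor S s w 0 (Function.update x w false) = 1 := by
  have : G.response w (Function.update x w false) =
      G.response w (Function.update x w true) := by
    refine response_congr fun u hu => ?_
    have : u ≠ w := by
      rintro rfl
      exact hw hu
    simp [this]
  unfold factor
  by_cases h1 : w ∈ S
  · cases hs : s w <;> simp [h1]
  · by_cases h2 : w = G.unit
    · simp [h1, ← h2]
    · simp [h1, h2, this]

/-- A node all of whose children are intervened on may itself be intervened on, as far as the
other nodes are concerned. -/
theorem expect_insert {w : V} (hw : w ∉ S) (h : ∀ u, G.edge w u → u ∈ S)
    {f : (V → Bool) → ℝ} {D : Set V} (hf : DependsOn f Dᶜ) (hD : w ∈ D) :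
    G.expect S s f = G.expect (insert w S) s f := by
  have hww : ¬ G.edge w w := fun e => hw (h w e)
  refine sum_eq_of_update_pairs w fun x => ?_
  have h' : ∀ u, G.edge w u → u ∈ insert w S := fun u hu => Or.inr (h u hu)
  have hprod : ∏ v ∈ Finset.univ.erase w, G.factor (insert w S) s v 0 x =
      ∏ v ∈ Finset.univ.erase w, G.factor S s v 0 x := by
    refine Finset.prod_congr rfl fun v hv => ?_
    have := Finset.ne_of_mem_erase hv
    simp [factor, this]
  rw [truncProb_update h, truncProb_update h, truncProb_update h', truncProb_update h',
    hf.update_eq hD, hf.update_eq hD, hprod, ← add_mul, ← add_mul, ← add_mul, ← add_mul,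
    factor_add_factor hww, factor_add_factor hww]

/-- When every child of `w` is intervened on, only the factor of `w` itself sees its value, so `w`
can be summed out. -/
theorem expect_ind_mul_of_children {w : V} (hw : w ∉ S) (hu : w ≠ G.unit)
    (h : ∀ u, G.edge w u → u ∈ S) {f : (V → Bool) → ℝ} {D : Set V} (hf : DependsOn f Dᶜ)
    (hD : w ∈ D) :
    G.expect S s (fun x => ind (x w) * f x) = G.expect S s (fun x => G.response w x * f x) := by
  have hww : ¬ G.edge w w := fun e => hw (h w e)
  refine sum_eq_of_update_pairs w fun x => ?_
  have hr : ∀ b, G.response w (Function.update x w b) = G.response w x := by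
    intro b
    refine response_congr fun u hu => ?_
    have : u ≠ w := by
      rintro rfl
      exact hww hu
    simp [this]
  have h1 := factor_add_factor (S := S) (s := s) hww x
  have h2 : G.factor S s w 0 (Function.update x w true) = G.response w x := by
    simp [factor, hw, hu, hr]
  simp only [truncProb_update h, hf.update_eq hD, hr]
  rw [h2] at h1 ⊢
  rw [eq_sub_of_add_eq' h1]
  simp [ind]
  ring

theorem wellFounded_flip (hac : ∀ v, ¬ Relation.TransGen G.edge v v) :
    WellFounded (flip G.edge) := by
  have : IsTrans V (flip (Relation.TransGen G.edge)) := ⟨fun _ _ _ h1 h2 => h2.trans h1⟩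
  have : Std.Irrefl (flip (Relation.TransGen G.edge)) := ⟨fun a h => hac a h⟩
  exact (Finite.wellFounded_of_trans_of_irrefl (flip (Relation.TransGen G.edge))).mono
    fun _ _ h => Relation.TransGen.single h

theorem wellFounded_edge (hac : ∀ v, ¬ Relation.TransGen G.edge v v) :
    WellFounded G.edge := by
  have : Std.Irrefl (Relation.TransGen G.edge) := ⟨fun a h => hac a h⟩
  exact (Finite.wellFounded_of_trans_of_irrefl (Relation.TransGen G.edge)).mono
    fun _ _ h => Relation.TransGen.single h

/-- Intervening on a set of nodes closed under taking children does not affect the others. -/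
theorem expect_union (hac : ∀ v, ¬ Relation.TransGen G.edge v v) {D : Set V}
    (hD : ∀ u ∈ D, ∀ w, G.edge u w → w ∈ D) {f : (V → Bool) → ℝ} (hf : DependsOn f Dᶜ)
    (S : Set V) : G.expect S s f = G.expect (S ∪ D) s f := by
  induction hn : (D \ S).ncard generalizing S with
  | zero =>
    rw [Set.ncard_eq_zero (Set.toFinite _), Set.sdiff_eq_empty] at hn
    rw [Set.union_eq_self_of_subset_right hn]
  | succ n ih =>
    have hne : (D \ S).Nonempty := by
      rw [← Set.ncard_pos (Set.toFinite _)]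
      omega
    -- A sink of `D \ S`: as `D` is closed under children, all children of `w` are already in `S`.
    obtain ⟨w, ⟨hwD, hwS⟩, hmin⟩ := (wellFounded_flip hac).has_min _ hne
    have hch : ∀ u, G.edge w u → u ∈ S := by
      intro u hu
      by_contra hus
      exact hmin u ⟨hD w hwD u hu, hus⟩ hu
    rw [expect_insert hwS hch hf hwD, ih (insert w S), Set.insert_union,
      Set.insert_eq_of_mem (show w ∈ S ∪ D from Or.inr hwD)]
    have : D \ insert w S = (D \ S) \ {w} := by
      ext a
      simp only [Set.mem_sdiff, Set.mem_insert_iff, Set.mem_singleton_iff]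
      tauto
    rw [this, Set.ncard_sdiff_singleton_of_mem (show w ∈ D \ S from ⟨hwD, hwS⟩), hn]
    rfl

/-- A constant depends on no node, so all nodes may be intervened on, which leaves the point mass at
`s`. -/
theorem expect_one (hac : ∀ v, ¬ Relation.TransGen G.edge v v) (S : Set V) :
    G.expect S s (fun _ => 1) = 1 := by
  rw [expect_union hac (D := Set.univ) (fun _ _ _ _ => Set.mem_univ _) (fun _ _ _ => rfl),
    Set.union_univ]
  unfold expect
  rw [Finset.sum_eq_single s]
  · simp [truncProb, factor]
  · intro x _ hx
    obtain ⟨v, hv⟩ := Function.ne_iff.mp hx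
    rw [truncProb, Finset.prod_eq_zero (Finset.mem_univ v), zero_mul]
    simp [factor, hv]
  · simp

/-- The causal Markov property: given its non-descendants, a node has value `1` with the
probability determined by its parents. -/
theorem expect_ind_mul (hac : ∀ v, ¬ Relation.TransGen G.edge v v) {v : V} (hv : v ∉ S)
    (hu : v ≠ G.unit) {f : (V → Bool) → ℝ}
    (hf : DependsOn f {w | Relation.ReflTransGen G.edge v w}ᶜ) :
    G.expect S s (fun x => ind (x v) * f x) = G.expect S s (fun x => G.response v x * f x) := by
  have hD : ∀ u ∈ {w | Relation.TransGen G.edge v w}, ∀ w, G.edge u w →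
      w ∈ {w | Relation.TransGen G.edge v w} := fun u h w e => h.tail e
  have hf' : ∀ x y : V → Bool, (∀ i ∈ {w | Relation.TransGen G.edge v w}ᶜ, x i = y i) →
      f x = f y := fun x y h => hf fun i hi => h i fun hi' => hi hi'.to_reflTransGen
  have h1 : DependsOn (fun x => ind (x v) * f x) {w | Relation.TransGen G.edge v w}ᶜ := by
    intro x y h
    simp only
    rw [hf' x y h, h v (hac v)]
  have h2 : DependsOn (fun x => G.response v x * f x) {w | Relation.TransGen G.edge v w}ᶜ := by
    intro x y h
    simp only
    rw [hf' x y h, response_congr fun u hu => h u fun hu' => hac v (hu'.tail hu)]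
  -- Both integrands ignore the proper descendants of `v`; intervening on these reduces to the case
  -- where all children of `v` are intervened on.
  rw [expect_union hac hD h1, expect_union hac hD h2]
  refine expect_ind_mul_of_children ?_ hu ?_ hf Relation.ReflTransGen.refl
  · rintro (h | h)
    · exact hv h
    · exact hac v h
  · intro u h
    exact Or.inr (Relation.TransGen.single h)

theorem truncProb_support {x : V → Bool} (hx : G.truncProb S s x ≠ 0) :
    (∀ v ∈ S, x v = s v) ∧ (G.unit ∉ S → x G.unit = true) := by
  have h := fun v => Finset.prod_ne_zero_iff.mp hx v (Finset.mem_univ v)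
  constructor
  · intro v hv
    by_contra hne
    exact h v (by simp [factor, hv, hne])
  · intro hu
    by_contra hne
    exact h G.unit (by simp [factor, hu, hne])

theorem expect_congr {f g : (V → Bool) → ℝ}
    (h : ∀ x, G.truncProb S s x ≠ 0 → f x = g x) : G.expect S s f = G.expect S s g := by
  refine Finset.sum_congr rfl fun x _ => ?_
  by_cases hx : G.truncProb S s x = 0
  · simp [hx]
  · rw [h x hx]

theorem expect_add (f g : (V → Bool) → ℝ) :
    G.expect S s (fun x => f x + g x) = G.expect S s f + G.expect S s g := by
  simp [expect, mul_add, Finset.sum_add_distrib]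

theorem expect_const_mul (c : ℝ) (f : (V → Bool) → ℝ) :
    G.expect S s (fun x => c * f x) = c * G.expect S s f := by
  simp only [expect, Finset.mul_sum]
  exact Finset.sum_congr rfl fun x _ => by ring

theorem expect_sum {ι : Type*} (t : Finset ι) (f : ι → (V → Bool) → ℝ) :
    G.expect S s (fun x => ∑ i ∈ t, f i x) = ∑ i ∈ t, G.expect S s (f i) := by
  simp only [expect, Finset.mul_sum]
  exact Finset.sum_comm

theorem expect_mono (h0 : ∀ x, 0 ≤ G.truncProb S s x) {f g : (V → Bool) → ℝ}
    (h : ∀ x, G.truncProb S s x ≠ 0 → f x ≤ g x) : G.expect S s f ≤ G.expect S s g := by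
  refine Finset.sum_le_sum fun x _ => ?_
  by_cases hx : G.truncProb S s x = 0
  · simp [hx]
  · exact mul_le_mul_of_nonneg_left (h x hx) (h0 x)

theorem expect_const (hac : ∀ v, ¬ Relation.TransGen G.edge v v) (c : ℝ) :
    G.expect S s (fun _ => c) = c := by
  have := expect_const_mul (G := G) (S := S) (s := s) c (fun _ => 1)
  simpa [expect_one hac] using this

/-! ### Averaging out the noises. -/

theorem mem_Icc_of_mean_zero {μ : Measure ℝ} [IsProbabilityMeasure μ] {c : NNReal}
    (hs : HasSubgaussianMGF (fun e : ℝ => e) c μ) (hm : ∫ e, e ∂μ = 0) {r : ℝ}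
    (h : ∀ᵐ e ∂μ, r + e ∈ Set.Icc (0 : ℝ) 1) : r ∈ Set.Icc (0 : ℝ) 1 := by
  have hi : Integrable (fun e : ℝ => r + e) μ := (integrable_const r).add hs.integrable
  have hr : ∫ e, (r + e) ∂μ = r := by
    rw [integral_add (integrable_const r) hs.integrable, hm]
    simp
  constructor
  · rw [← hr]
    exact integral_nonneg_of_ae (h.mono fun e he => he.1)
  · calc r = ∫ e, (r + e) ∂μ := hr.symm
      _ ≤ ∫ _, (1 : ℝ) ∂μ := integral_mono_ae hi (integrable_const 1) (h.mono fun e he => he.2)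
      _ = 1 := by simp

theorem IsBLM.response_mem (hG : G.IsBLM) {v : V} (hv : v ≠ G.unit) {x : V → Bool}
    (hx : x G.unit = true) : G.response v x ∈ Set.Icc (0 : ℝ) 1 := by
  have := hG.noise_prob v
  obtain ⟨c, hc⟩ := hG.noise_subgaussian v hv
  exact mem_Icc_of_mean_zero hc (hG.noise_mean v hv) (hG.prob_mem v hv x hx)

theorem IsBLM.jointProb_eq (hG : G.IsBLM) (S : Set V) (s x : V → Bool) :
    G.jointProb S s x = G.truncProb S s x := by
  have := hG.noise_prob
  unfold jointProb truncProb
  rw [integral_fintype_prod_eq_prod (fun v e => G.factor S s v e x)]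
  refine Finset.prod_congr rfl fun v _ => ?_
  unfold factor
  by_cases h1 : v ∈ S
  · simp [h1]
  by_cases h2 : v = G.unit
  · simp [h2]
  obtain ⟨c, hc⟩ := hG.noise_subgaussian v h2
  have hm : ∫ e, (G.response v x + e) ∂(G.noise v) = G.response v x := by
    rw [integral_add (integrable_const _) hc.integrable, hG.noise_mean v h2]
    simp
  cases hx : x v
  · simp only [h1, h2, if_false, Bool.false_eq_true, add_zero]
    have hi : Integrable (fun e : ℝ => G.response v x + e) (G.noise v) :=
      (integrable_const _).add hc.integrable
    rw [integral_sub (integrable_const _) hi, hm]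
    simp
  · simp [h1, h2, hm]

theorem IsBLM.factor_nonneg (hG : G.IsBLM) {x : V → Bool} (hx : x G.unit = true) (v : V) :
    0 ≤ G.factor S s v 0 x := by
  unfold factor
  by_cases h1 : v ∈ S
  · simp only [h1, if_true]
    split_ifs <;> norm_num
  by_cases h2 : v = G.unit
  · simp only [h2, if_true]
    split_ifs <;> norm_num
  obtain ⟨ha, hb⟩ := hG.response_mem h2 hx
  simp only [h1, h2, if_false, add_zero]
  split_ifs <;> linarith

/-- Responses are controlled only where the constant node has value `1`; elsewhere its own factor
makes the product vanish. -/
theorem IsBLM.truncProb_nonneg (hG : G.IsBLM) (hS : G.unit ∉ S) (x : V → Bool) :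
    0 ≤ G.truncProb S s x := by
  by_cases hx : G.truncProb S s x = 0
  · exact hx.ge
  · exact Finset.prod_nonneg fun v _ => hG.factor_nonneg ((truncProb_support hx).2 hS) v

theorem IsBLM.doLaw_apply (hG : G.IsBLM) (hS : G.unit ∉ S) (A : Set (V → Bool)) :
    G.doLaw S s A = ENNReal.ofReal (G.expect S s (A.indicator 1)) := by
  unfold doLaw expect
  rw [ENNReal.ofReal_sum_of_nonneg]
  · rw [Measure.coe_finsetSum, Finset.sum_apply]
    refine Finset.sum_congr rfl fun x _ => ?_
    rw [hG.jointProb_eq, Measure.smul_apply, Measure.dirac_apply' _ A.toFinite.measurableSet,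
      smul_eq_mul]
    by_cases hx : x ∈ A <;> simp [hx]
  · intro x _
    exact mul_nonneg (hG.truncProb_nonneg hS x) (Set.indicator_nonneg (by simp) x)

end Expectation

/-! ### Sums over hidden paths, and averaging out hidden ancestors. -/

section HiddenPaths

variable {V : Type*} {G : LinearCausalModel V}

theorem isHiddenPath_concat {a b c : V} {p : List V} :
    G.IsHiddenPath a (p ++ [c]) b ↔ G.IsHiddenPath a p c ∧ c ∈ G.hidden ∧ G.edge c b := by
  induction p generalizing a with
  | nil => simp only [List.nil_append, IsHiddenPath]
  | cons d p ih => simp only [List.cons_append, IsHiddenPath, ih]; tauto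

theorem pathWeight_concat (a b c : V) (p : List V) :
    G.pathWeight a (p ++ [c]) b = G.pathWeight a p c * G.weight c b := by
  induction p generalizing a with
  | nil => rfl
  | cons d p ih => simp only [List.cons_append, pathWeight, ih, mul_assoc]

theorem IsHiddenPath.transGen {a b : V} {p : List V} (h : G.IsHiddenPath a p b) :
    Relation.TransGen G.edge a b := by
  induction p generalizing a with
  | nil => exact Relation.TransGen.single h
  | cons c p ih => exact (ih h.2.2).head h.1

theorem pathWeight_nonneg (h0 : ∀ u v, G.edge u v → 0 ≤ G.weight u v) {a b : V} {p : List V}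
    (h : G.IsHiddenPath a p b) : 0 ≤ G.pathWeight a p b := by
  induction p generalizing a with
  | nil => exact h0 _ _ h
  | cons c p ih => exact mul_nonneg (h0 _ _ h.1) (ih h.2.2)

/-- A directed path to an observed node starts with a hidden path to an observed node. -/
theorem exists_isHiddenPath_of_transGen {a z : V} (h : Relation.TransGen G.edge a z)
    (hz : z ∉ G.hidden) :
    ∃ w, w ∉ G.hidden ∧ (∃ p, G.IsHiddenPath a p w) ∧ Relation.ReflTransGen G.edge w z := by
  induction h using Relation.TransGen.head_induction_on with
  | single h => exact ⟨z, hz, ⟨[], h⟩, .refl⟩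
  | @head a c hac hcz ih =>
    by_cases hc : c ∈ G.hidden
    · obtain ⟨w, hw, ⟨p, hp⟩, hwz⟩ := ih
      exact ⟨w, hw, ⟨c :: p, hac, hc, hp⟩, hwz⟩
    · exact ⟨c, hc, ⟨[], hac⟩, hcz.to_reflTransGen⟩

/-- The sum of the weights of all hidden paths from `a` to `b`. -/
def pathSum (G : LinearCausalModel V) (a b : V) : ℝ :=
  ∑ᶠ p ∈ {p : List V | G.IsHiddenPath a p b}, G.pathWeight a p b

theorem pathSum_nonneg (h0 : ∀ u v, G.edge u v → 0 ≤ G.weight u v) (a b : V) :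
    0 ≤ G.pathSum a b :=
  finsum_nonneg fun _ => finsum_nonneg fun hp => pathWeight_nonneg h0 hp

theorem pathSum_eq_zero {a b : V} (h : ¬ ∃ p, G.IsHiddenPath a p b) : G.pathSum a b = 0 :=
  finsum_mem_eq_zero_of_forall_eq_zero fun p hp => (h ⟨p, hp⟩).elim

variable [Fintype V]

/-- Paths are split at their last intermediate node because responses are sums over incoming edges.
-/
theorem setOf_isHiddenPath (a b : V) :
    {p | G.IsHiddenPath a p b} = (if G.edge a b then {[]} else ∅) ∪
      ⋃ c ∈ (↑(Finset.univ.filter fun c => G.edge c b ∧ c ∈ G.hidden) : Set V),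
        (fun q => q ++ [c]) '' {q | G.IsHiddenPath a q c} := by
  ext p
  have h1 : p ∈ (if G.edge a b then {[]} else ∅ : Set (List V)) ↔ p = [] ∧ G.edge a b := by
    split_ifs with h <;> simp [h]
  rw [Set.mem_union, h1]
  rcases List.eq_nil_or_concat p with rfl | ⟨q, c, rfl⟩
  · simp [IsHiddenPath]
  · simp only [List.concat_eq_append, Set.mem_ofPred_eq, isHiddenPath_concat]
    simp
    tauto

/-- Needed because `finsum` is additive only for finite supports. -/
theorem finite_isHiddenPath (hac : ∀ v, ¬ Relation.TransGen G.edge v v) (a b : V) :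
    {p | G.IsHiddenPath a p b}.Finite := by
  induction b using (wellFounded_edge hac).induction with
  | _ b ih =>
    rw [setOf_isHiddenPath]
    refine Set.Finite.union (by split_ifs <;> simp) ?_
    refine Set.Finite.biUnion (Finset.finite_toSet _) fun c hc => ?_
    have hc' : G.edge c b ∧ c ∈ G.hidden := by simpa using hc
    exact (ih c hc'.1).image _

theorem pathSum_rec (hac : ∀ v, ¬ Relation.TransGen G.edge v v) (a b : V) :
    G.pathSum a b = (if G.edge a b then G.weight a b else 0) +
      ∑ c with G.edge c b ∧ c ∈ G.hidden, G.weight c b * G.pathSum a c := by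
  have hfin : ∀ c, ((fun q : List V => q ++ [c]) '' {q | G.IsHiddenPath a q c}).Finite :=
    fun c => (finite_isHiddenPath hac a c).image _
  unfold pathSum
  rw [setOf_isHiddenPath, finsum_mem_union, finsum_mem_biUnion, finsum_mem_coe_finset]
  · congr 1
    · split_ifs with h
      · simp [pathWeight]
      · simp
    · refine Finset.sum_congr rfl fun c _ => ?_
      rw [finsum_mem_image fun p _ q _ hpq => List.append_cancel_right hpq,
        mul_comm, finsum_mem_mul]
      simp only [pathWeight_concat]
  · intro c _ d _ hcd
    refine Set.disjoint_left.mpr ?_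
    rintro _ ⟨p, _, rfl⟩ ⟨q, _, hq⟩
    exact hcd (by simpa using (List.append_inj' hq rfl).2.symm)
  · exact Finset.finite_toSet _
  · exact fun c _ => hfin c
  · refine Set.disjoint_left.mpr ?_
    intro p hp hp'
    have : p = [] := by
      split_ifs at hp
      · exact hp
      · exact hp.elim
    subst this
    simp at hp'
  · split_ifs <;> simp
  · exact Set.Finite.biUnion (Finset.finite_toSet _) fun c _ => hfin c

/-- The expected value of `v` given the observed nodes with hidden paths to `v`. -/
def linPart (G : LinearCausalModel V) (v : V) (x : V → Bool) : ℝ :=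
  G.pathSum G.unit v + ∑ z : G.Obs, G.pathSum z v * ind (x z)

theorem linPart_rec (hac : ∀ v, ¬ Relation.TransGen G.edge v v)
    (hin : ∀ v, ¬ G.edge v G.unit) (hunit : G.unit ∈ G.hidden) (v : V) (x : V → Bool) :
    G.linPart v x = ∑ u with G.edge u v, G.weight u v *
      (if u = G.unit then 1 else if u ∈ G.hidden then G.linPart u x else ind (x u)) := by
  -- The constant node is hidden but its `linPart` is `0`, not `1`: its contribution is the
  -- direct-edge term of `pathSum_rec`, so it is not counted twice.
  have hu : G.linPart G.unit x = 0 := by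
    have : ∀ a, G.pathSum a G.unit = 0 := by
      intro a
      rw [pathSum_rec hac]
      simp [hin]
    simp [linPart, this]
  have h1 : ∑ u with G.edge u v, G.weight u v *
      (if u = G.unit then 1 else if u ∈ G.hidden then G.linPart u x else ind (x u)) =
      ∑ u, ((if u = G.unit then (if G.edge u v then G.weight u v else 0) else 0) +
        (if G.edge u v ∧ u ∈ G.hidden then G.weight u v * G.linPart u x else 0) +
        (if u ∉ G.hidden then (if G.edge u v then G.weight u v else 0) * ind (x u) else 0)) := by
    rw [Finset.sum_filter]
    refine Finset.sum_congr rfl fun u _ => ?_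
    by_cases h1 : u = G.unit
    · subst h1
      simp [hunit, hu]
    · by_cases h2 : u ∈ G.hidden <;> by_cases h3 : G.edge u v <;> simp [h1, h2, h3]
  have h3 : ∀ g : V → ℝ, ∑ u with u ∉ G.hidden, g u = ∑ z : G.Obs, g z :=
    fun g => Finset.sum_subtype _ (by simp) g
  rw [h1, Finset.sum_add_distrib, Finset.sum_add_distrib, Finset.sum_ite_eq' Finset.univ G.unit,
    ← Finset.sum_filter, ← Finset.sum_filter (fun u => u ∉ G.hidden), h3]
  simp only [Finset.mem_univ, if_true]
  conv_lhs => rw [linPart, pathSum_rec hac]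
  have h2 : ∀ z : G.Obs, G.pathSum z v * ind (x z) =
      (if G.edge z v then G.weight z v else 0) * ind (x z) +
      ∑ c with G.edge c v ∧ c ∈ G.hidden, G.weight c v * (G.pathSum z c * ind (x z)) := by
    intro z
    rw [pathSum_rec hac, add_mul, Finset.sum_mul]
    simp only [mul_assoc]
  simp only [h2]
  rw [Finset.sum_add_distrib, Finset.sum_comm]
  simp only [linPart, mul_add, Finset.sum_add_distrib, Finset.mul_sum]
  ring

variable {S : Set V} {s : V → Bool}

/-- Hidden ancestors may be averaged out of the Markov property. -/
theorem expect_ind_mul_eq_linPart (hac : ∀ v, ¬ Relation.TransGen G.edge v v)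
    (hin : ∀ v, ¬ G.edge v G.unit) (hunit : G.unit ∈ G.hidden) (hS : ∀ v ∈ S, v ∉ G.hidden)
    {f : (V → Bool) → ℝ} (v : V) (hv : v ∉ S) (hvu : v ≠ G.unit)
    (hf : DependsOn f {w | Relation.ReflTransGen G.edge v w}ᶜ)
    (hfh : ∀ h ∈ G.hidden, h ≠ G.unit → (∃ p, G.IsHiddenPath h p v) →
      DependsOn f {w | Relation.ReflTransGen G.edge h w}ᶜ) :
    G.expect S s (fun x => ind (x v) * f x) = G.expect S s (fun x => G.linPart v x * f x) := by
  induction v using (wellFounded_edge hac).induction with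
  | _ v ih =>
    rw [expect_ind_mul hac hv hvu hf]
    simp only [linPart_rec hac hin hunit v, response, Finset.sum_mul, mul_assoc]
    rw [expect_sum, expect_sum]
    refine Finset.sum_congr rfl fun u hu => ?_
    have huv : G.edge u v := (Finset.mem_filter.mp hu).2
    rw [expect_const_mul, expect_const_mul]
    congr 1
    by_cases h1 : u = G.unit
    · refine expect_congr fun x hx => ?_
      have := (truncProb_support hx).2 fun h => hS _ h hunit
      simp [h1, this]
    by_cases h2 : u ∈ G.hidden
    · simp only [h1, h2, if_true, if_false]
      -- The condition on hidden ancestors is inherited by `u`, since a hidden path to `u` extends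
      -- through `u` to `v`.
      refine ih u huv (fun h => hS _ h h2) h1 (hfh u h2 h1 ⟨[], huv⟩) ?_
      rintro h hh hhu ⟨p, hp⟩
      exact hfh h hh hhu ⟨p ++ [u], isHiddenPath_concat.mpr ⟨hp, h2, huv⟩⟩
    · simp [h1, h2, ind]

end HiddenPaths

/-! ### Conditional probabilities as identities between expectations. -/

section Conditioning

variable {V : Type*} {G : LinearCausalModel V}

theorem ind_nonneg (b : Bool) : 0 ≤ ind b := by
  cases b <;> simp [ind]

theorem ind_le_one (b : Bool) : ind b ≤ 1 := by
  cases b <;> simp [ind]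

theorem ind_mul_indicator (A : Set (V → Bool)) (v : V) (x : V → Bool) :
    ind (x v) * A.indicator 1 x = (A ∩ {x | x v = true}).indicator 1 x := by
  by_cases hA : x ∈ A <;> by_cases hv : x v = true <;> simp [hA, hv, ind]

/-- The event that the observed nodes with hidden paths to `b` have the values `pa`. -/
def parentEvent (G : LinearCausalModel V) (b : G.Obs) (pa : Option G.Obs → Bool) :
    Set (V → Bool) :=
  {x | ∀ z : G.Obs, (∃ p, G.IsHiddenPath z p b) → x z = pa (some z)}

theorem unit_ne_obs (hunit : G.unit ∈ G.hidden) (b : G.Obs) : (b : V) ≠ G.unit :=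
  fun h => b.2 (h ▸ hunit)

theorem dependsOn_indicator_parentEvent (b : G.Obs) (pa : Option G.Obs → Bool) {D : Set V}
    (hD : ∀ z : G.Obs, (∃ p, G.IsHiddenPath z p b) → (z : V) ∉ D) :
    DependsOn ((G.parentEvent b pa).indicator (1 : (V → Bool) → ℝ)) Dᶜ := by
  intro x y hxy
  have : x ∈ G.parentEvent b pa ↔ y ∈ G.parentEvent b pa :=
    forall_congr' fun z => forall_congr' fun hz => by rw [hxy z (hD z hz)]
  by_cases hx : x ∈ G.parentEvent b pa
  · simp [hx, this.mp hx]
  · simp [hx, mt this.mpr hx]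

variable [Fintype V] {S : Set V} {s : V → Bool}

theorem IsBLM.cond_doLaw (hG : G.IsBLM) (hS : G.unit ∉ S) {A : Set (V → Bool)} {v : V} {r : ℝ}
    (hr : 0 ≤ r) (hA : G.doLaw S s A ≠ 0)
    (h : G.expect S s (fun x => ind (x v) * A.indicator 1 x) =
      r * G.expect S s (A.indicator 1)) :
    ProbabilityTheory.cond (G.doLaw S s) A {x | x v = true} = ENNReal.ofReal r := by
  have h1 : G.doLaw S s (A ∩ {x | x v = true}) = ENNReal.ofReal r * G.doLaw S s A := by
    rw [hG.doLaw_apply hS, hG.doLaw_apply hS, ← ENNReal.ofReal_mul hr, ← h]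
    simp only [ind_mul_indicator]
  rw [cond_apply A.toFinite.measurableSet, h1, mul_comm (ENNReal.ofReal r), ← mul_assoc,
    ENNReal.inv_mul_cancel hA, one_mul]
  rw [hG.doLaw_apply hS]
  exact ENNReal.ofReal_ne_top

theorem IsBLM.eq_zero_of_expect_eq_zero (hG : G.IsBLM) (hS : G.unit ∉ S)
    {f : (V → Bool) → ℝ} (hf : ∀ x, 0 ≤ f x) (h : G.expect S s f = 0) {x : V → Bool}
    (hx : G.truncProb S s x ≠ 0) : f x = 0 := by
  have := (Finset.sum_eq_zero_iff_of_nonneg fun x _ =>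
    mul_nonneg (hG.truncProb_nonneg hS x) (hf x)).mp h x (Finset.mem_univ x)
  exact (mul_eq_zero.mp this).resolve_left hx

theorem expect_ind_mul_of_mem {v : V} (hv : v ∈ S) (f : (V → Bool) → ℝ) :
    G.expect S s (fun x => ind (x v) * f x) = ind (s v) * G.expect S s f := by
  rw [← expect_const_mul]
  refine expect_congr fun x hx => ?_
  rw [(truncProb_support hx).1 v hv]

theorem IsBLM.weight_nonneg (hG : G.IsBLM) (u v : V) (h : G.edge u v) : 0 ≤ G.weight u v :=
  (hG.weight_mem u v h).1

/-! ### The transformed model is a Markovian BLM. -/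

/-- The expectation of `b` when all other observed nodes are intervened on. -/
theorem IsBLM.expect_do_others (hG : G.IsBLM) (hunit : G.unit ∈ G.hidden) (b : G.Obs)
    (s : V → Bool) :
    G.expect {v | v ∉ G.hidden ∧ v ≠ b} s (fun x => ind (x b)) =
      G.pathSum G.unit b + ∑ z : G.Obs, G.pathSum z b * ind (s z) := by
  have h := expect_ind_mul_eq_linPart (S := {v | v ∉ G.hidden ∧ v ≠ b}) (s := s) hG.acyclic
    hG.no_edge_into_unit hunit (fun v hv => hv.1) (f := fun _ => 1) b (by simp)
    (unit_ne_obs hunit b) (fun _ _ _ => rfl) (fun _ _ _ _ _ _ _ => rfl)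
  simp only [mul_one] at h
  rw [h, expect_congr (g := fun _ => _), expect_const hG.acyclic]
  intro x hx
  unfold linPart
  congr 1
  refine Finset.sum_congr rfl fun z _ => ?_
  -- The node `b` is not intervened on, but its coefficient vanishes by acyclicity.
  by_cases hz : z = b
  · subst hz
    rw [pathSum_eq_zero, zero_mul, zero_mul]
    rintro ⟨p, hp⟩
    exact hG.acyclic _ hp.transGen
  · rw [(truncProb_support hx).1 z ⟨z.2, fun h => hz (Subtype.ext h)⟩]

/-- Setting the other observed nodes to `0` leaves only the hidden paths from the constant node. -/
theorem IsBLM.transform_weight_none (hG : G.IsBLM) (hunit : G.unit ∈ G.hidden) (b : G.Obs) :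
    G.transform.weight none (some b) = G.pathSum G.unit b := by
  change (G.doLaw {v | v ∉ G.hidden ∧ v ≠ b} (fun _ => false)).real {x | x b = true} = _
  have h := hG.expect_do_others hunit b (fun _ => false)
  have h0 : ind false = 0 := rfl
  simp only [h0, mul_zero, Finset.sum_const_zero, add_zero] at h
  rw [Measure.real, hG.doLaw_apply (fun h => h.1 hunit), ENNReal.toReal_ofReal, ← h]
  · congr 1
    ext x
    by_cases hx : x b = true <;> simp [hx, ind]
  · exact Finset.sum_nonneg fun x _ => mul_nonneg (hG.truncProb_nonneg (fun h => h.1 hunit) x)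
      (Set.indicator_nonneg (by simp) x)

theorem IsBLM.transform_response (hG : G.IsBLM) (hunit : G.unit ∈ G.hidden) (b : G.Obs)
    (x : Option G.Obs → Bool) :
    G.transform.response (some b) x =
      G.pathSum G.unit b * ind (x none) + ∑ z : G.Obs, G.pathSum z b * ind (x (some z)) := by
  unfold response
  rw [Finset.sum_filter, Fintype.sum_option,
    if_pos (show G.transform.edge none (some b) from trivial), hG.transform_weight_none hunit]
  congr 1
  refine Finset.sum_congr rfl fun z _ => ?_
  by_cases h : ∃ p, G.IsHiddenPath z p b
  · rw [if_pos (show G.transform.edge (some z) (some b) from h)]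
    rfl
  · rw [if_neg (show ¬ G.transform.edge (some z) (some b) from h), pathSum_eq_zero h, zero_mul]

/-- The observed nodes of `x`, as values in the original model. -/
def extendValues (G : LinearCausalModel V) (x : Option G.Obs → Bool) (v : V) : Bool :=
  if h : v ∉ G.hidden then x (some ⟨v, h⟩) else true

/-- Both sides compute the probability that `b` is `1` when all other observed nodes are set by `x`.
-/
theorem IsBLM.transform_response_eq_expect (hG : G.IsBLM) (hunit : G.unit ∈ G.hidden) (b : G.Obs)
    {x : Option G.Obs → Bool} (hx : x none = true) :
    G.transform.response (some b) x =
      G.expect {v | v ∉ G.hidden ∧ v ≠ b} (G.extendValues x) (fun x => G.response b x) := by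
  have h := expect_ind_mul (S := {v | v ∉ G.hidden ∧ v ≠ b}) (s := G.extendValues x) hG.acyclic
    (f := fun _ => 1) (v := b) (by simp) (unit_ne_obs hunit b) (fun _ _ _ => rfl)
  simp only [mul_one] at h
  have hz : ∀ z : G.Obs, G.extendValues x z = x (some z) := fun z => dif_pos z.2
  rw [← h, hG.expect_do_others hunit, hG.transform_response hunit, hx]
  simp [ind, hz]

theorem IsBLM.transform_prob_mem (hG : G.IsBLM) (hunit : G.unit ∈ G.hidden) (b : G.Obs)
    {x : Option G.Obs → Bool} (hx : x none = true) :
    ∀ᵐ e ∂(G.noise b), G.transform.response (some b) x + e ∈ Set.Icc (0 : ℝ) 1 := by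
  -- There are finitely many `y`, so one null set serves all; for fixed `e` the bounds then survive
  -- averaging over `y`.
  have h : ∀ᵐ e ∂(G.noise b), ∀ y : V → Bool, y G.unit = true →
      G.response b y + e ∈ Set.Icc (0 : ℝ) 1 := by
    rw [ae_all_iff]
    intro y
    by_cases hy : y G.unit = true
    · filter_upwards [hG.prob_mem b (unit_ne_obs hunit b) y hy] with e he _ using he
    · simp [hy]
  have hS : G.unit ∉ {v | v ∉ G.hidden ∧ v ≠ b} := fun h => h.1 hunit
  filter_upwards [h] with e he
  have he' : G.transform.response (some b) x + e =
      G.expect {v | v ∉ G.hidden ∧ v ≠ b} (G.extendValues x) (fun x => G.response b x + e) := by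
    rw [expect_add, expect_const hG.acyclic, hG.transform_response_eq_expect hunit b hx]
  rw [he']
  constructor
  · have := expect_mono (s := G.extendValues x) (hG.truncProb_nonneg hS) (f := fun _ => 0)
      fun y hy => (he y ((truncProb_support hy).2 hS)).1
    rwa [expect_const hG.acyclic] at this
  · have := expect_mono (s := G.extendValues x) (hG.truncProb_nonneg hS) (g := fun _ => 1)
      fun y hy => (he y ((truncProb_support hy).2 hS)).2
    rwa [expect_const hG.acyclic] at this

/-- The start may be the new constant node, which has no counterpart in `G`; the end cannot be. For
`w = w'` this gives acyclicity. -/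
theorem transform_transGen {w w' : Option G.Obs} (h : Relation.TransGen G.transform.edge w w') :
    ∃ b : G.Obs, w' = some b ∧ ∀ a : G.Obs, w = some a → Relation.TransGen G.edge a b := by
  induction h with
  | @single w' h =>
    match w, w', h with
    | some a, some b, h =>
      obtain ⟨p, hp⟩ := h
      exact ⟨b, rfl, fun a' ha => Option.some_injective _ ha ▸ hp.transGen⟩
    | none, some b, _ => exact ⟨b, rfl, fun a ha => (Option.some_ne_none a ha.symm).elim⟩
  | @tail w₁ w₂ _ h ih =>
    obtain ⟨c, rfl, hc⟩ := ih
    match w₂, h with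
    | some b, h =>
      obtain ⟨p, hp⟩ := h
      exact ⟨b, rfl, fun a ha => (hc a ha).trans hp.transGen⟩

theorem IsBLM.transform (hG : G.IsBLM) (hunit : G.unit ∈ G.hidden) : G.transform.IsBLM where
  acyclic v h := by
    obtain ⟨b, rfl, hb⟩ := transform_transGen h
    exact hG.acyclic _ (hb b rfl)
  no_edge_into_unit v h := by
    cases v <;> exact h
  no_edge_from_target v h := by
    cases v with
    | none => exact h
    | some b =>
      obtain ⟨p, hp⟩ := h
      cases p with
      | nil => exact hG.no_edge_from_target _ hp
      | cons c p => exact hG.no_edge_from_target _ hp.1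
  target_ne_unit := Option.some_ne_none _
  weight_mem u v h := by
    have hresp : ∀ (b : G.Obs) (x : Option G.Obs → Bool), x none = true →
        G.transform.response (some b) x ∈ Set.Icc (0 : ℝ) 1 := by
      intro b x hx
      have := hG.noise_prob b
      obtain ⟨c, hc⟩ := hG.noise_subgaussian b (unit_ne_obs hunit b)
      exact mem_Icc_of_mean_zero hc (hG.noise_mean b (unit_ne_obs hunit b))
        (hG.transform_prob_mem hunit b hx)
    -- With all parents equal to `1`, the response is the sum of all incoming weights, which are
    -- nonnegative.
    have hsum : ∀ a b : G.Obs, G.pathSum G.unit b + G.pathSum a b ≤ 1 := by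
      intro a b
      refine le_trans ?_ (hresp b (fun _ => true) rfl).2
      rw [hG.transform_response hunit]
      simp only [ind, if_true, mul_one]
      gcongr
      exact Finset.single_le_sum (f := fun z : G.Obs => G.pathSum z b)
        (fun z _ => pathSum_nonneg hG.weight_nonneg _ _) (Finset.mem_univ a)
    match u, v, h with
    | some a, some b, _ =>
      change G.pathSum a b ∈ _
      have h0 := pathSum_nonneg hG.weight_nonneg G.unit b
      exact ⟨pathSum_nonneg hG.weight_nonneg _ _, by linarith [hsum a b]⟩
    | none, some b, _ =>
      rw [hG.transform_weight_none hunit]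
      have h0 := pathSum_nonneg hG.weight_nonneg b b
      exact ⟨pathSum_nonneg hG.weight_nonneg _ _, by linarith [hsum b b]⟩
  noise_prob v := by
    cases v with
    | none => exact Measure.dirac.isProbabilityMeasure
    | some b => exact hG.noise_prob b
  noise_subgaussian v hv := by
    cases v with
    | none => exact (hv rfl).elim
    | some b => exact hG.noise_subgaussian b (unit_ne_obs hunit b)
  noise_mean v hv := by
    cases v with
    | none => exact (hv rfl).elim
    | some b => exact hG.noise_mean b (unit_ne_obs hunit b)
  prob_mem v hv x hx := by
    cases v with
    | none => exact (hv rfl).elim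
    | some b => exact hG.transform_prob_mem hunit b hx

theorem isMarkovian_transform (G : LinearCausalModel V) : G.transform.IsMarkovian := by
  refine ⟨rfl, fun v hv => ?_⟩
  cases v with
  | none => exact (hv rfl).elim
  | some b => exact trivial

/-! ### Conditioning on the parents in both models. -/

/-- Given its parents in the transformed model, a node has value `1` with the probability
determined by the weights of the transformed model. -/
theorem IsBLM.expect_ind_mul_parentEvent (hG : G.IsBLM) (hunit : G.unit ∈ G.hidden)
    (hfork : G.NoHiddenForkToDescendant) (hS : ∀ v ∈ S, v ∉ G.hidden) {b : G.Obs}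
    (hb : (b : V) ∉ S) {pa : Option G.Obs → Bool} (hpa : pa none = true) :
    G.expect S s (fun x => ind (x b) * (G.parentEvent b pa).indicator 1 x) =
      G.transform.response (some b) pa * G.expect S s ((G.parentEvent b pa).indicator 1) := by
  rw [expect_ind_mul_eq_linPart hG.acyclic hG.no_edge_into_unit hunit hS b hb
    (unit_ne_obs hunit b), ← expect_const_mul]
  · congr 1
    ext x
    by_cases hx : x ∈ G.parentEvent b pa
    · congr 1
      rw [hG.transform_response hunit, linPart, hpa]
      congr 1
      · simp [ind]
      · refine Finset.sum_congr rfl fun z _ => ?_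
        by_cases hz : ∃ p, G.IsHiddenPath z p b
        · rw [hx z hz]
        · simp [pathSum_eq_zero hz]
    · simp [hx]
  · refine dependsOn_indicator_parentEvent b pa ?_
    rintro z ⟨p, hp⟩ hz
    exact hG.acyclic _ (Relation.TransGen.trans_right hz hp.transGen)
  · intro h hh hhu hhb
    refine dependsOn_indicator_parentEvent b pa ?_
    rintro z ⟨p, hp⟩ hz
    rcases Relation.reflTransGen_iff_eq_or_transGen.mp hz with heq | hz
    · exact z.2 (heq ▸ hh)
    -- A parent `z` below `h` yields a first observed node `w` on the way from `h` to `z`. Then `b`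
    -- descends from `w`, and `h` has hidden paths to both, a forbidden fork.
    · obtain ⟨w, hw, hhw, hwz⟩ := exists_isHiddenPath_of_transGen hz z.2
      exact hfork h hh hhu ⟨w, hw⟩ b (Relation.TransGen.trans_right hwz hp.transGen) ⟨hhw, hhb⟩

/-- The observed values of positive probability in the original model have positive probability in
the transformed model. -/
theorem IsBLM.truncProb_transform_ne_zero (hG : G.IsBLM) (hunit : G.unit ∈ G.hidden)
    (hfork : G.NoHiddenForkToDescendant) (hS : ∀ v ∈ S, v ∉ G.hidden) {x : V → Bool}
    (hx : G.truncProb S s x ≠ 0) :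
    G.transform.truncProb (G.liftNodes S) (G.liftValues s) (G.liftValues x) ≠ 0 := by
  have huS : G.unit ∉ S := fun h => hS _ h hunit
  refine Finset.prod_ne_zero_iff.mpr fun v _ => ?_
  cases v with
  | none =>
    have h1 : (none : Option G.Obs) ∉ G.liftNodes S := by simp [liftNodes]
    have h2 : (none : Option G.Obs) = G.transform.unit := rfl
    have h3 : G.liftValues x none = true := rfl
    simp [factor, h1, ← h2, h3]
  | some b =>
    have h2 : some b ≠ G.transform.unit := Option.some_ne_none b
    have h3 : ∀ y, G.liftValues y (some b) = y b := fun _ => rfl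
    by_cases hb : (b : V) ∈ S
    · have h1 : some b ∈ G.liftNodes S := ⟨b, rfl, hb⟩
      simp [factor, h1, h3, (truncProb_support hx).1 b hb]
    · have h1 : some b ∉ G.liftNodes S := by
        rintro ⟨a, ha, haS⟩
        exact hb (Option.some_injective _ ha ▸ haS)
      have hid := hG.expect_ind_mul_parentEvent (S := S) (s := s) hunit hfork hS hb
        (pa := G.liftValues x) rfl
      have hA : x ∈ G.parentEvent b (G.liftValues x) := fun z _ => rfl
      have hA0 : ∀ y, 0 ≤ (G.parentEvent b (G.liftValues x)).indicator (1 : (V → Bool) → ℝ) y :=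
        Set.indicator_nonneg (by simp)
      simp only [factor, h1, h2, h3, if_false, add_zero]
      -- A vanishing factor means that the response is `0` or `1`, opposite to `x b`. Then `hid`
      -- makes the expectation of a nonnegative function vanish, although that function is `1` at
      -- the atom `x`.
      intro h0
      cases hxb : x b
      · have hr : G.transform.response (some b) (G.liftValues x) = 1 := by
          simp only [hxb, Bool.false_eq_true, if_false] at h0
          linarith
        rw [hr, one_mul] at hid
        have h5 : G.expect S s (fun y => (1 - ind (y b)) *
            (G.parentEvent b (G.liftValues x)).indicator 1 y) = 0 := by
          have := expect_add (G := G) (S := S) (s := s)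
            (fun y => ind (y b) * (G.parentEvent b (G.liftValues x)).indicator 1 y)
            (fun y => (1 - ind (y b)) * (G.parentEvent b (G.liftValues x)).indicator 1 y)
          rw [hid] at this
          have h6 : ∀ y : V → Bool,
              ind (y b) * (G.parentEvent b (G.liftValues x)).indicator (1 : (V → Bool) → ℝ) y +
              (1 - ind (y b)) * (G.parentEvent b (G.liftValues x)).indicator 1 y =
              (G.parentEvent b (G.liftValues x)).indicator 1 y := fun y => by ring
          simp only [h6] at this
          linarith
        have := hG.eq_zero_of_expect_eq_zero huS
          (fun y => mul_nonneg (sub_nonneg.mpr (ind_le_one _)) (hA0 y)) h5 hx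
        simp [hA, hxb, ind] at this
      · have hr : G.transform.response (some b) (G.liftValues x) = 0 := by
          simpa [hxb] using h0
        rw [hr, zero_mul] at hid
        have := hG.eq_zero_of_expect_eq_zero huS
          (fun y => mul_nonneg (ind_nonneg _) (hA0 y)) hid hx
        simp [hA, hxb, ind] at this

theorem IsBLM.transform_expect_ind_mul (hG : G.IsBLM) (hunit : G.unit ∈ G.hidden)
    {T : Set (Option G.Obs)} {t : Option G.Obs → Bool} {w : Option G.Obs} (hw : w ∉ T)
    (hwu : w ≠ G.transform.unit) (pa : Option G.Obs → Bool) :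
    G.transform.expect T t
        (fun x => ind (x w) * {x | ∀ z, G.transform.edge z w → x z = pa z}.indicator 1 x) =
      G.transform.response w pa *
        G.transform.expect T t ({x | ∀ z, G.transform.edge z w → x z = pa z}.indicator 1) := by
  have hac := (hG.transform hunit).acyclic
  rw [expect_ind_mul hac hw hwu, ← expect_const_mul]
  · congr 1
    ext x
    by_cases hx : ∀ z, G.transform.edge z w → x z = pa z
    · rw [response_congr hx]
    · simp [hx]
  · intro x y hxy
    have : (∀ z, G.transform.edge z w → x z = pa z) ↔ ∀ z, G.transform.edge z w → y z = pa z :=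
      forall_congr' fun z => forall_congr' fun hz => by
        rw [hxy z fun h => hac w (Relation.TransGen.trans_right h (.single hz))]
    simp [Set.indicator, this]

end Conditioning

end LinearCausalModel

end

theorem mainTheorem7 {V : Type*} [Fintype V] (G : LinearCausalModel V) (hG : G.IsBLM)
    (hunit : G.unit ∈ G.hidden) (hG' : G.NoHiddenForkToDescendant) :
    G.transform.IsBLM ∧ G.transform.IsMarkovian ∧
    ∀ (X : G.Obs) (S : Set V) (s : V → Bool) (pa : Option G.Obs → Bool),
      S ⊆ {v | v ∉ G.hidden ∧ v ≠ G.target} →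
      pa none = true →
      (∀ Z : G.Obs, G.transform.edge (some Z) (some X) → (Z : V) ∈ S → pa (some Z) = s Z) →
      G.doLaw S s {x | ∀ Z : G.Obs, G.transform.edge (some Z) (some X) → x Z = pa (some Z)} ≠ 0 →
      G.transform.doLaw (G.liftNodes S) (G.liftValues s)
          {x | ∀ Z, G.transform.edge Z (some X) → x Z = pa Z} ≠ 0 ∧
      ProbabilityTheory.cond (G.doLaw S s)
          {x | ∀ Z : G.Obs, G.transform.edge (some Z) (some X) → x Z = pa (some Z)}
          {x | x X = true} =
        ProbabilityTheory.cond (G.transform.doLaw (G.liftNodes S) (G.liftValues s))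
          {x | ∀ Z, G.transform.edge Z (some X) → x Z = pa Z}
          {x | x (some X) = true} := by
  have hT := hG.transform hunit
  refine ⟨hT, LinearCausalModel.isMarkovian_transform G, fun X S s pa hS hpa _ hpos => ?_⟩
  have hSh : ∀ v ∈ S, v ∉ G.hidden := fun v hv => (hS hv).1
  have huS : G.unit ∉ S := fun h => hSh _ h hunit
  have huT : G.transform.unit ∉ G.liftNodes S := by
    rintro ⟨a, ha, _⟩
    exact Option.some_ne_none a ha.symm
  change G.doLaw S s (G.parentEvent X pa) ≠ 0 at hpos
  have hpos' : G.transform.doLaw (G.liftNodes S) (G.liftValues s)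
      {x | ∀ Z, G.transform.edge Z (some X) → x Z = pa Z} ≠ 0 := by
    rw [hT.doLaw_apply huT]
    rw [hG.doLaw_apply huS] at hpos
    intro h0
    have hA0 : ∀ x, 0 ≤ {x | ∀ Z, G.transform.edge Z (some X) → x Z = pa Z}.indicator
        (1 : (Option G.Obs → Bool) → ℝ) x := Set.indicator_nonneg (by simp)
    have h0' := le_antisymm (ENNReal.ofReal_eq_zero.mp h0)
      (Finset.sum_nonneg fun x _ => mul_nonneg (hT.truncProb_nonneg huT x) (hA0 x))
    refine hpos ?_
    -- An atom of `G` inside the parent event would give an atom of the transformed model inside an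
    -- event assumed null.
    rw [LinearCausalModel.expect_congr (g := fun _ => 0), LinearCausalModel.expect_const hG.acyclic,
      ENNReal.ofReal_zero]
    intro x hx
    by_contra hne
    have hxA : x ∈ G.parentEvent X pa := by
      by_contra hxA
      exact hne (by simp [hxA])
    have h1 := hT.eq_zero_of_expect_eq_zero huT hA0 h0'
      (hG.truncProb_transform_ne_zero hunit hG' hSh hx)
    rw [Set.indicator_of_mem] at h1
    · exact one_ne_zero h1
    · intro Z hZ
      cases Z with
      | none => exact hpa.symm
      | some Z => exact hxA Z hZ
  refine ⟨hpos', ?_⟩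
  change ProbabilityTheory.cond (G.doLaw S s) (G.parentEvent X pa) _ = _
  -- If `X` is intervened on, both conditional probabilities are `ind (s X)`; otherwise both are the
  -- transformed response at `pa`.
  by_cases hX : (X : V) ∈ S
  · rw [hG.cond_doLaw huS (LinearCausalModel.ind_nonneg (s X)) hpos
        (LinearCausalModel.expect_ind_mul_of_mem hX _),
      hT.cond_doLaw huT (LinearCausalModel.ind_nonneg (s X)) hpos'
        (LinearCausalModel.expect_ind_mul_of_mem
          (show some X ∈ G.liftNodes S from ⟨X, rfl, hX⟩) _)]
  · have hXT : some X ∉ G.liftNodes S := by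
      rintro ⟨a, ha, haS⟩
      exact hX (Option.some_injective _ ha ▸ haS)
    have hr := (hT.response_mem (v := some X) (Option.some_ne_none X) hpa).1
    rw [hG.cond_doLaw huS hr hpos (hG.expect_ind_mul_parentEvent hunit hG' hSh hX hpa),
      hT.cond_doLaw huT hr hpos'
        (hG.transform_expect_ind_mul hunit hXT (Option.some_ne_none X) pa)]
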